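/- Let $A$ be a simple unital $C^*$-algebra, let $\alpha$ be a $*$-automorphism of $A$, and suppose that the $C^*$-dynamical system $(A,\mathbb Z,\alpha)$ is $2\mathbb Z$-inner, i.e. that there is a unitary $z\in A$ with $\alpha(z)=z$ and $\alpha^2=\mathrm{Ad}(z)$, where $\mathrm{Ad}(z)(a)=zaz^*$; fix such a $z$. Let $X_\alpha$ be the vector space $A$ with the left action of $A$ by multiplication, the right action $x\cdot a=x\,\alpha(a)$, and the $A$-valued inner products ${}_A\langle x,y\rangle=xy^*$ and $\langle x,y\rangle_A=\alpha^{-1}(x^*y)$. This is an $A$-$A$-equivalence bimodule, and $x^\sharp=z^*\alpha(x^*)$ is an involution on it, that is, a conjugate linear map with $(x^\sharp)^\sharp=x$, $(a\cdot x\cdot b)^\sharp=b^*\cdot x^\sharp\cdot a^*$ and ${}_A\langle x,y^\sharp\rangle=\langle x^\sharp,y\rangle_A$. Let $\widetilde{X_\alpha}$ be the dual bimodule: its elements are the symbols $\widetilde x$, $x\in X_\alpha$, with $\lambda\widetilde x=(\bar\lambda x)^\sim$ and $b\cdot\widetilde x\cdot a=(a^*\cdot x\cdot b^*)^\sim$.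 Let $$L=\left\{\begin{bmatrix}a&x\\ \widetilde y&b\end{bmatrix} : a,b\in A,\ x,y\in X_\alpha\right\}$$ be the linking algebra, with the matrix multiplication in which $x\widetilde y={}_A\langle x,y\rangle$ and $\widetilde y x=\langle y,x\rangle_A$, with the adjoint $\begin{bmatrix}a&x\\ \widetilde y&b\end{bmatrix}^*=\begin{bmatrix}a^*&y\\ \widetilde x&b^*\end{bmatrix}$, and with the operator norm from its action on the right Hilbert $A$-module $X_\alpha\oplus A$; it is a $C^*$-algebra. Let $$B_{X_\alpha}=\left\{\begin{bmatrix}a&x\\ \widetilde{x^\sharp}&a\end{bmatrix} : a\in A,\ x\in X_\alpha\right\},$$ which is a $C^*$-subalgebra of $L$, and regard $A$ as the subalgebra of $B_{X_\alpha}$ formed by the diagonal matrices with both diagonal entries equal to $a\in A$. Then the following conditions are equivalent: 1. $B_{X_\alpha}$ is simple, i.e. it is nonzero and has no closed two-sided ideals other than $0$ and itself; 2. $A'\cap B_{X_\alpha}=\mathbb C\cdot 1$; 3. $B_{X_\alpha}'\cap L=\mathbb C\cdot 1$; 4. $\alpha$ is outer, i.e. there is no unitary $w\in A$ with $\alpha(a)=waw^*$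 for all $a\in A$. Here $A'$ and $B_{X_\alpha}'$ denote the commutants in $L$. -/

import Mathlib

namespace BimoduleIndexTwo

open MulOpposite

universe u v

set_option linter.unusedSectionVars false

/-! ### Equivalence bimodules -/

section Inner

variable {A : Type u} {X : Type v} [CStarAlgebra A] [PartialOrder A]
  [NormedAddCommGroup X] [NormedSpace ℂ X] [Module A X] [Module Aᵐᵒᵖ X]
  [CStarModule A X] [CStarModule Aᵐᵒᵖ X]

/-- The left `A`-valued inner product, linear in the first variable and conjugate linear in the
second one. (In `CStarModule` the linear variable is the second one.) -/
def leftInner (x y : X) : A := inner A y x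

/-- The right `A`-valued inner product, conjugate linear in the first variable and linear in the
second one. A right Hilbert `A`-module is a `CStarModule` over `Aᵐᵒᵖ`. -/
def rightInner (x y : X) : A := unop (inner Aᵐᵒᵖ x y)

end Inner

/-- `X` is an `A`-`A`-equivalence bimodule. The arguments say that `X` is a left and a right
(pre-)Hilbert `A`-module for one and the same norm; the fields add that `X` is complete, that the
actions of `A`, `A` and `ℂ` are compatible, that `X` is full on both sides, and that
`⟨x, y⟩ · w = x · ⟨y, w⟩` for the left and the right inner product. -/
class EquivalenceBimodule (A : Type u) (X : Type v) [CStarAlgebra A] [PartialOrder A]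
    [NormedAddCommGroup X] [NormedSpace ℂ X] [Module A X] [Module Aᵐᵒᵖ X]
    [CStarModule A X] [CStarModule Aᵐᵒᵖ X] : Prop extends
    CompleteSpace X, SMulCommClass A Aᵐᵒᵖ X where
  csmul_smul_left (c : ℂ) (a : A) (x : X) : (c • a) • x = c • (a • x)
  csmul_smul_right (c : ℂ) (a : A) (x : X) : op (c • a) • x = c • (op a • x)
  left_full : closure (Submodule.span ℂ {a : A | ∃ x y : X, leftInner x y = a} : Set A) = Set.univ
  right_full : closure (Submodule.span ℂ {a : A | ∃ x y : X, rightInner x y = a} : Set A) = Set.univ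
  leftInner_smul (x y w : X) : leftInner (A := A) x y • w = op (rightInner (A := A) y w) • x

/-- An involution `x ↦ x♯` on an `A`-`A`-equivalence bimodule. -/
structure Involution (A : Type u) (X : Type v) [CStarAlgebra A] [PartialOrder A]
    [NormedAddCommGroup X] [NormedSpace ℂ X] [Module A X] [Module Aᵐᵒᵖ X]
    [CStarModule A X] [CStarModule Aᵐᵒᵖ X] where
  /-- the map `x ↦ x♯` -/
  sharp : X → X
  sharp_add (x y : X) : sharp (x + y) = sharp x + sharp y
  sharp_smul (c : ℂ) (x : X) : sharp (c • x) = star c • sharp x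
  sharp_sharp (x : X) : sharp (sharp x) = x
  sharp_bimodule (a b : A) (x : X) :
    sharp (op b • (a • x)) = op (star a) • (star b • sharp x)
  leftInner_sharp (x y : X) : leftInner (A := A) x (sharp y) = rightInner (sharp x) y

/-! ### The linking algebra -/

/-- `A` as a right Hilbert `A`-module: `⟨a, b⟩ = a* b`. -/
instance rightSelf (A : Type u) [CStarAlgebra A] [PartialOrder A] [StarOrderedRing A] :
    CStarModule Aᵐᵒᵖ A where
  inner a b := op (star a * b)
  inner_add_right := by intros; simp [mul_add]
  inner_self_nonneg {x} := star_mul_self_nonneg x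
  inner_self {x} := by simp
  inner_op_smul_right {a x y} := by
    apply unop_injective; simp [mul_assoc]
  inner_smul_right_complex := by intros; simp
  star_inner x y := by apply unop_injective; simp
  norm_eq_sqrt_norm_inner_self x := by
    rw [op_mul, op_star, CStarRing.norm_self_mul_star, norm_op, Real.sqrt_mul_self (norm_nonneg _)]

/-- The matrix with rows `(a, x)` and `(ỹ, b)`, where `a, b ∈ A`, `x ∈ X` and `ỹ` is the element
`y ∈ X` viewed in the dual bimodule. -/
@[ext]
structure Linking (A : Type u) (X : Type v) where
  /-- upper left entry -/
  a : A
  /-- upper right entry -/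
  x : X
  /-- the element of `X` that stands, viewed in the dual bimodule, in the lower left corner -/
  y : X
  /-- lower right entry -/
  b : A

section BasicLemmas

variable {A : Type u} {X : Type v} [CStarAlgebra A] [PartialOrder A]
  [NormedAddCommGroup X] [NormedSpace ℂ X] [Module A X] [Module Aᵐᵒᵖ X]
  [CStarModule A X] [CStarModule Aᵐᵒᵖ X]

lemma leftInner_add_left (x x' y : X) :
    leftInner (A := A) (x + x') y = leftInner x y + leftInner x' y := by simp [leftInner]
lemma leftInner_add_right (x y y' : X) :
    leftInner (A := A) x (y + y') = leftInner x y + leftInner x y' := by simp [leftInner]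
lemma leftInner_smul_left (a : A) (x y : X) :
    leftInner (A := A) (a • x) y = a * leftInner x y := by simp [leftInner]
lemma leftInner_smul_right (a : A) (x y : X) :
    leftInner (A := A) x (a • y) = leftInner x y * star a := by simp [leftInner]
lemma star_leftInner (x y : X) : star (leftInner (A := A) x y) = leftInner y x := by
  simp [leftInner]
lemma leftInner_csmul_left (c : ℂ) (x y : X) :
    leftInner (A := A) (c • x) y = c • leftInner x y := by simp [leftInner]
lemma leftInner_csmul_right (c : ℂ) (x y : X) :
    leftInner (A := A) x (c • y) = star c • leftInner x y := by simp [leftInner]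
lemma rightInner_add_left (x x' y : X) :
    rightInner (A := A) (x + x') y = rightInner x y + rightInner x' y := by simp [rightInner]
lemma rightInner_add_right (x y y' : X) :
    rightInner (A := A) x (y + y') = rightInner x y + rightInner x y' := by simp [rightInner]
lemma rightInner_smul_right (a : A) (x y : X) :
    rightInner (A := A) x (op a • y) = rightInner x y * a := by simp [rightInner]
lemma rightInner_smul_left (a : A) (x y : X) :
    rightInner (A := A) (op a • x) y = star a * rightInner x y := by simp [rightInner]
lemma star_rightInner (x y : X) : star (rightInner (A := A) x y) = rightInner y x := by
  rw [rightInner, ← unop_star, CStarModule.star_inner, rightInner]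
lemma rightInner_csmul_right (c : ℂ) (x y : X) :
    rightInner (A := A) x (c • y) = c • rightInner x y := by simp [rightInner]
lemma rightInner_csmul_left (c : ℂ) (x y : X) :
    rightInner (A := A) (c • x) y = star c • rightInner x y := by simp [rightInner]

lemma norm_smul_le_left (a : A) (x : X) : ‖a • x‖ ≤ ‖a‖ * ‖x‖ := by
  have h : ‖a • x‖ ^ 2 ≤ (‖a‖ * ‖x‖) ^ 2 := by
    rw [CStarModule.norm_sq_eq A, CStarModule.inner_op_smul_right, CStarModule.inner_op_smul_left]
    calc ‖a * (inner A x x * star a)‖ ≤ ‖a‖ * (‖inner A x x‖ * ‖star a‖) :=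
          (norm_mul_le _ _).trans (by gcongr; exact norm_mul_le _ _)
      _ = (‖a‖ * ‖x‖) ^ 2 := by rw [norm_star, ← CStarModule.norm_sq_eq A]; ring
  exact (abs_le_of_sq_le_sq' h (by positivity)).2

lemma norm_smul_le_right (a : A) (x : X) : ‖op a • x‖ ≤ ‖x‖ * ‖a‖ := by
  have h : ‖op a • x‖ ^ 2 ≤ (‖x‖ * ‖a‖) ^ 2 := by
    rw [CStarModule.norm_sq_eq Aᵐᵒᵖ, CStarModule.inner_op_smul_right,
      CStarModule.inner_op_smul_left]
    calc ‖op a * (inner Aᵐᵒᵖ x x * star (op a))‖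
        ≤ ‖op a‖ * (‖inner Aᵐᵒᵖ x x‖ * ‖star (op a)‖) :=
          (norm_mul_le _ _).trans (by gcongr; exact norm_mul_le _ _)
      _ = (‖x‖ * ‖a‖) ^ 2 := by rw [norm_star, ← CStarModule.norm_sq_eq Aᵐᵒᵖ, norm_op]; ring
  exact (abs_le_of_sq_le_sq' h (by positivity)).2

lemma norm_rightInner_le [StarOrderedRing A] (x y : X) :
    ‖rightInner (A := A) x y‖ ≤ ‖x‖ * ‖y‖ := by
  rw [rightInner, norm_unop]
  exact CStarModule.norm_inner_le X

lemma norm_leftInner_le [StarOrderedRing A] (x y : X) :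
    ‖leftInner (A := A) x y‖ ≤ ‖x‖ * ‖y‖ := by
  rw [leftInner, mul_comm]
  exact CStarModule.norm_inner_le X

variable [StarOrderedRing A] [EquivalenceBimodule A X]

lemma exists_sum_leftInner :
    ∃ l : List (X × X), (l.map fun p => leftInner (A := A) p.1 p.2).sum = 1 := by
  have key : ∀ s ∈ Submodule.span ℂ {a : A | ∃ x y : X, leftInner x y = a}, ∀ t : A,
      ∃ l : List (X × X), (l.map fun p => leftInner (A := A) p.1 p.2).sum = t * s := by
    intro s hs
    induction hs using Submodule.span_induction with
    | mem s hs =>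
      obtain ⟨x, y, rfl⟩ := hs
      exact fun t => ⟨[(t • x, y)], by simp [leftInner_smul_left]⟩
    | zero => exact fun t => ⟨[], by simp⟩
    | add s s' _ _ h h' =>
      intro t
      obtain ⟨l, hl⟩ := h t
      obtain ⟨l', hl'⟩ := h' t
      exact ⟨l ++ l', by rw [List.map_append, List.sum_append, hl, hl', mul_add]⟩
    | smul c s _ h =>
      intro t
      obtain ⟨l, hl⟩ := h (c • t)
      exact ⟨l, by rw [hl, smul_mul_assoc, mul_smul_comm]⟩
  have h1 : (1 : A) ∈ closure (Submodule.span ℂ {a : A | ∃ x y : X, leftInner x y = a} : Set A) := by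
    rw [EquivalenceBimodule.left_full]; trivial
  obtain ⟨s, hs, h⟩ := Metric.mem_closure_iff.1 h1 1 one_pos
  rw [dist_eq_norm] at h
  obtain ⟨u, hu⟩ := isUnit_one_sub_of_norm_lt_one h
  rw [sub_sub_cancel] at hu
  obtain ⟨l, hl⟩ := key s hs ↑u⁻¹
  exact ⟨l, by rw [hl, ← hu, Units.inv_mul]⟩

lemma exists_sum_rightInner :
    ∃ l : List (X × X), (l.map fun p => rightInner (A := A) p.1 p.2).sum = 1 := by
  have key : ∀ s ∈ Submodule.span ℂ {a : A | ∃ x y : X, rightInner x y = a}, ∀ t : A,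
      ∃ l : List (X × X), (l.map fun p => rightInner (A := A) p.1 p.2).sum = s * t := by
    intro s hs
    induction hs using Submodule.span_induction with
    | mem s hs =>
      obtain ⟨x, y, rfl⟩ := hs
      exact fun t => ⟨[(x, op t • y)], by simp [rightInner_smul_right]⟩
    | zero => exact fun t => ⟨[], by simp⟩
    | add s s' _ _ h h' =>
      intro t
      obtain ⟨l, hl⟩ := h t
      obtain ⟨l', hl'⟩ := h' t
      exact ⟨l ++ l', by rw [List.map_append, List.sum_append, hl, hl', add_mul]⟩
    | smul c s _ h =>
      intro t
      obtain ⟨l, hl⟩ := h (c • t)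
      exact ⟨l, by rw [hl, smul_mul_assoc, mul_smul_comm]⟩
  have h1 : (1 : A) ∈
      closure (Submodule.span ℂ {a : A | ∃ x y : X, rightInner x y = a} : Set A) := by
    rw [EquivalenceBimodule.right_full]; trivial
  obtain ⟨s, hs, h⟩ := Metric.mem_closure_iff.1 h1 1 one_pos
  rw [dist_eq_norm] at h
  obtain ⟨u, hu⟩ := isUnit_one_sub_of_norm_lt_one h
  rw [sub_sub_cancel] at hu
  obtain ⟨l, hl⟩ := key s hs ↑u⁻¹
  exact ⟨l, by rw [hl, ← hu, Units.mul_inv]⟩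

/-- The left action is bounded below. -/
lemma exists_bound_left : ∃ C : ℝ, 0 ≤ C ∧ ∀ (a : A) (K : ℝ), 0 ≤ K →
    (∀ x : X, ‖a • x‖ ≤ K * ‖x‖) → ‖a‖ ≤ C * K := by
  obtain ⟨l, hl⟩ := exists_sum_leftInner (A := A) (X := X)
  refine ⟨(l.map fun p => ‖p.1‖ * ‖p.2‖).sum, List.sum_nonneg (by
    simp only [List.mem_map]; rintro _ ⟨p, -, rfl⟩; positivity), fun a K hK h => ?_⟩
  rw [← mul_one a, ← hl]
  clear hl
  induction l with
  | nil => simp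
  | cons p l ih =>
    rw [List.map_cons, List.sum_cons, List.map_cons, List.sum_cons, mul_add, add_mul]
    refine (norm_add_le _ _).trans (add_le_add ?_ ih)
    rw [← leftInner_smul_left]
    calc _ ≤ ‖a • p.1‖ * ‖p.2‖ := norm_leftInner_le _ _
      _ ≤ (K * ‖p.1‖) * ‖p.2‖ := by gcongr; exact h _
      _ = _ := by ring

lemma eq_zero_of_left {a : A} (h : ∀ x : X, a • x = 0) : a = 0 := by
  obtain ⟨C, -, hC⟩ := exists_bound_left (A := A) (X := X)
  have := hC a 0 le_rfl fun x => by simp [h]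
  simpa using this

lemma eq_zero_of_right {a : A} (h : ∀ x : X, op a • x = 0) : a = 0 := by
  obtain ⟨l, hl⟩ := exists_sum_rightInner (A := A) (X := X)
  rw [← one_mul a, ← hl]
  clear hl
  induction l with
  | nil => simp
  | cons p l ih =>
    rw [List.map_cons, List.sum_cons, add_mul, ih, ← rightInner_smul_right, h]
    simp [rightInner]

/-- The left action is by adjointable operators. -/
lemma rightInner_smul_adjoint (a : A) (x y : X) :
    rightInner (A := A) (a • x) y = rightInner x (star a • y) := by
  rw [← sub_eq_zero]
  refine eq_zero_of_right (X := X) fun w => ?_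
  rw [op_sub, sub_smul, ← EquivalenceBimodule.leftInner_smul, ← EquivalenceBimodule.leftInner_smul,
    leftInner_smul_right, mul_smul, sub_self]

/-- The right action is by adjointable operators. -/
lemma leftInner_smul_adjoint (a : A) (x y : X) :
    leftInner (A := A) (op a • x) y = leftInner x (op (star a) • y) := by
  rw [← sub_eq_zero]
  refine eq_zero_of_left (X := X) fun w => ?_
  rw [sub_smul, EquivalenceBimodule.leftInner_smul, EquivalenceBimodule.leftInner_smul,
    rightInner_smul_left, star_star, op_mul, mul_smul, sub_self]

end BasicLemmas
namespace Linking

section Operations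

variable {A : Type u} {X : Type v} [CStarAlgebra A] [PartialOrder A]
  [NormedAddCommGroup X] [NormedSpace ℂ X] [Module A X] [Module Aᵐᵒᵖ X]
  [CStarModule A X] [CStarModule Aᵐᵒᵖ X]

instance : Zero (Linking A X) := ⟨⟨0, 0, 0, 0⟩⟩
instance : One (Linking A X) := ⟨⟨1, 0, 0, 1⟩⟩
instance : Add (Linking A X) := ⟨fun m n => ⟨m.a + n.a, m.x + n.x, m.y + n.y, m.b + n.b⟩⟩
instance : Neg (Linking A X) := ⟨fun m => ⟨-m.a, -m.x, -m.y, -m.b⟩⟩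
instance : Sub (Linking A X) := ⟨fun m n => ⟨m.a - n.a, m.x - n.x, m.y - n.y, m.b - n.b⟩⟩

/-- Matrix multiplication. In the dual bimodule `ỹ · a = (a* · y)~` and `b · ỹ = (y · b*)~`, and
the products of `X` with its dual are `x ỹ = ⟨x, y⟩` (left inner product) and `ỹ x = ⟨y, x⟩` (right
inner product). -/
instance : Mul (Linking A X) := ⟨fun m n =>
  ⟨m.a * n.a + leftInner m.x n.y,
   m.a • n.x + op n.b • m.x,
   star n.a • m.y + op (star m.b) • n.y,
   rightInner m.y n.x + m.b * n.b⟩⟩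

/-- The adjoint of the matrix with rows `(a, x)`, `(ỹ, b)` has rows `(a*, y)`, `(x̃, b*)`. -/
instance : Star (Linking A X) := ⟨fun m => ⟨star m.a, m.y, m.x, star m.b⟩⟩

/-- In the dual bimodule `c ỹ = (c̄ y)~`. -/
instance : SMul ℂ (Linking A X) := ⟨fun c m => ⟨c • m.a, c • m.x, star c • m.y, c • m.b⟩⟩

instance : SMul ℕ (Linking A X) := ⟨fun n m => ⟨n • m.a, n • m.x, n • m.y, n • m.b⟩⟩
instance : SMul ℤ (Linking A X) := ⟨fun n m => ⟨n • m.a, n • m.x, n • m.y, n • m.b⟩⟩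
instance : NatCast (Linking A X) := ⟨fun n => ⟨n, 0, 0, n⟩⟩
instance : IntCast (Linking A X) := ⟨fun n => ⟨n, 0, 0, n⟩⟩
instance : Pow (Linking A X) ℕ := ⟨fun m n => npowRec n m⟩

lemma zero_def : (0 : Linking A X) = ⟨0, 0, 0, 0⟩ := rfl
lemma one_def : (1 : Linking A X) = ⟨1, 0, 0, 1⟩ := rfl
lemma add_def (m n : Linking A X) :
    m + n = ⟨m.a + n.a, m.x + n.x, m.y + n.y, m.b + n.b⟩ := rfl
lemma neg_def (m : Linking A X) : -m = ⟨-m.a, -m.x, -m.y, -m.b⟩ := rfl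
lemma sub_def (m n : Linking A X) :
    m - n = ⟨m.a - n.a, m.x - n.x, m.y - n.y, m.b - n.b⟩ := rfl
lemma mul_def (m n : Linking A X) : m * n =
    ⟨m.a * n.a + leftInner m.x n.y, m.a • n.x + op n.b • m.x,
     star n.a • m.y + op (star m.b) • n.y, rightInner m.y n.x + m.b * n.b⟩ := rfl
lemma star_def (m : Linking A X) : star m = ⟨star m.a, m.y, m.x, star m.b⟩ := rfl
lemma smul_def (c : ℂ) (m : Linking A X) :
    c • m = ⟨c • m.a, c • m.x, star c • m.y, c • m.b⟩ := rfl

end Operations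

variable {A : Type u} {X : Type v} [CStarAlgebra A] [PartialOrder A] [StarOrderedRing A]
  [NormedAddCommGroup X] [NormedSpace ℂ X] [Module A X] [Module Aᵐᵒᵖ X]
  [CStarModule A X] [CStarModule Aᵐᵒᵖ X] [EquivalenceBimodule A X]

lemma csmul_comm_left (c : ℂ) (a : A) (x : X) : a • (c • x) = c • (a • x) := by
  have h : c • x = (c • (1 : A)) • x := by
    rw [EquivalenceBimodule.csmul_smul_left, one_smul]
  rw [h, ← mul_smul, mul_smul_comm, mul_one, EquivalenceBimodule.csmul_smul_left]

lemma csmul_comm_right (c : ℂ) (a : A) (x : X) : op a • (c • x) = c • (op a • x) := by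
  have h : c • x = op (c • (1 : A)) • x := by
    rw [EquivalenceBimodule.csmul_smul_right, op_one, one_smul]
  rw [h, ← mul_smul, ← op_mul, smul_mul_assoc, one_mul, EquivalenceBimodule.csmul_smul_right]

variable (A X) in
/-- The right Hilbert `A`-module `X ⊕ A`, with `⟨(x, a), (y, b)⟩ = ⟨x, y⟩ + a* b` and the norm
given by this inner product. -/
abbrev Space := WithCStarModule Aᵐᵒᵖ (X × A)

/-- A matrix acting on the columns of `X ⊕ A`, as a linear map:
`(ξ, c) ↦ (a · ξ + x · c, ⟨y, ξ⟩ + b c)`. -/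
def toLin (m : Linking A X) : (X × A) →ₗ[ℂ] (X × A) where
  toFun p := (m.a • p.1 + op p.2 • m.x, rightInner m.y p.1 + m.b * p.2)
  map_add' p q := by
    ext
    · simp only [Prod.fst_add, Prod.snd_add, smul_add, op_add, add_smul]; abel
    · simp only [Prod.fst_add, Prod.snd_add, mul_add, rightInner_add_right]; abel
  map_smul' c p := by
    ext
    · simp only [Prod.smul_fst, Prod.smul_snd, RingHom.id_apply, smul_add, csmul_comm_left,
        EquivalenceBimodule.csmul_smul_right]
    · simp only [Prod.smul_fst, Prod.smul_snd, RingHom.id_apply, smul_add, mul_smul_comm,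
        rightInner_csmul_right]

/-- A matrix acting on the columns of the Hilbert module `X ⊕ A`, as a bounded operator. -/
noncomputable def toOp (m : Linking A X) : Space A X →L[ℂ] Space A X :=
  let T : (X × A) →L[ℂ] (X × A) := m.toLin.mkContinuous (‖m.a‖ + ‖m.x‖ + ‖m.y‖ + ‖m.b‖) (by
    intro p
    have h1 := norm_fst_le p
    have h2 := norm_snd_le p
    refine max_le ?_ ?_
    · calc ‖m.a • p.1 + op p.2 • m.x‖ ≤ ‖m.a‖ * ‖p.1‖ + ‖m.x‖ * ‖p.2‖ :=
            (norm_add_le _ _).trans (add_le_add (norm_smul_le_left _ _) (norm_smul_le_right _ _))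
        _ ≤ ‖m.a‖ * ‖p‖ + ‖m.x‖ * ‖p‖ := by gcongr
        _ ≤ (‖m.a‖ + ‖m.x‖ + ‖m.y‖ + ‖m.b‖) * ‖p‖ := by
            have := mul_nonneg (norm_nonneg m.y) (norm_nonneg p)
            have := mul_nonneg (norm_nonneg m.b) (norm_nonneg p)
            linarith
    · calc ‖rightInner m.y p.1 + m.b * p.2‖ ≤ ‖m.y‖ * ‖p.1‖ + ‖m.b‖ * ‖p.2‖ :=
            (norm_add_le _ _).trans (add_le_add (norm_rightInner_le _ _) (norm_mul_le _ _))
        _ ≤ ‖m.y‖ * ‖p‖ + ‖m.b‖ * ‖p‖ := by gcongr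
        _ ≤ (‖m.a‖ + ‖m.x‖ + ‖m.y‖ + ‖m.b‖) * ‖p‖ := by
            have := mul_nonneg (norm_nonneg m.a) (norm_nonneg p)
            have := mul_nonneg (norm_nonneg m.x) (norm_nonneg p)
            linarith)
  (WithCStarModule.equivL ℂ).symm.toContinuousLinearMap ∘L T ∘L
    (WithCStarModule.equivL ℂ).toContinuousLinearMap

/-- An element of `X ⊕ A`. -/
def vec (x : X) (a : A) : Space A X := (WithCStarModule.equiv Aᵐᵒᵖ (X × A)).symm (x, a)

lemma toOp_vec (m : Linking A X) (ξ : X) (c : A) : m.toOp (vec ξ c) =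
    vec (m.a • ξ + op c • m.x) (rightInner m.y ξ + m.b * c) := rfl

lemma op_ext {S T : Space A X →L[ℂ] Space A X} (h : ∀ ξ c, S (vec ξ c) = T (vec ξ c)) : S = T :=
  ContinuousLinearMap.ext fun p => h p.1 p.2

lemma vec_inj {x x' : X} {a a' : A} (h : (vec x a : Space A X) = vec x' a') : x = x' ∧ a = a' :=
  Prod.ext_iff.1 h

lemma toOp_injective : Function.Injective (toOp : Linking A X → (Space A X →L[ℂ] Space A X)) := by
  intro m n h
  have h' (ξ : X) (c : A) :
      m.a • ξ + op c • m.x = n.a • ξ + op c • n.x ∧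
        rightInner m.y ξ + m.b * c = rightInner n.y ξ + n.b * c := vec_inj (DFunLike.congr_fun h (vec ξ c) :
    vec (m.a • ξ + op c • m.x) (rightInner m.y ξ + m.b * c) =
      vec (n.a • ξ + op c • n.x) (rightInner n.y ξ + n.b * c))
  have hx : m.x = n.x := by simpa using (h' 0 1).1
  have hb : m.b = n.b := by simpa [rightInner] using (h' 0 1).2
  have ha : m.a = n.a := by
    rw [← sub_eq_zero]
    refine eq_zero_of_left (X := X) fun x => ?_
    simpa [sub_smul, sub_eq_zero] using (h' x 0).1
  have hy : m.y = n.y := by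
    rw [← sub_eq_zero, ← CStarModule.inner_self (A := Aᵐᵒᵖ), CStarModule.inner_sub_left,
      sub_eq_zero]
    have h2 := (h' (m.y - n.y) 0).2
    rw [mul_zero, mul_zero, add_zero, add_zero] at h2
    exact unop_injective h2
  exact Linking.ext ha hx hy hb

lemma toOp_zero : (0 : Linking A X).toOp = 0 := op_ext fun ξ c => by
  rw [toOp_vec, zero_def]
  simp only [zero_smul, smul_zero, add_zero, zero_mul]
  simp only [rightInner, CStarModule.inner_zero_left]
  rfl

lemma toOp_one : (1 : Linking A X).toOp = 1 := op_ext fun ξ c => by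
  rw [toOp_vec, one_def]
  simp [rightInner]

lemma toOp_add (m n : Linking A X) : (m + n).toOp = m.toOp + n.toOp := op_ext fun ξ c => by
  rw [add_apply, toOp_vec, toOp_vec, toOp_vec, add_def]
  simp only [add_smul, smul_add, add_mul, rightInner_add_left]
  refine Prod.ext ?_ ?_
  · exact add_add_add_comm ..
  · exact add_add_add_comm ..

lemma toOp_mul (m n : Linking A X) : (m * n).toOp = m.toOp * n.toOp := op_ext fun ξ c => by
  rw [mul_apply_eq_comp, toOp_vec, toOp_vec, toOp_vec, mul_def]
  congr 1
  · simp only [add_smul, smul_add, mul_smul, op_add, op_mul, EquivalenceBimodule.leftInner_smul,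
      ← smul_comm m.a (op c) n.x]
    abel
  · simp only [rightInner_add_left, rightInner_add_right, rightInner_smul_adjoint,
      rightInner_smul_left, rightInner_smul_right, star_star, add_mul, mul_add, mul_assoc]
    abel

lemma toOp_smul (c : ℂ) (m : Linking A X) : (c • m).toOp = c • m.toOp := op_ext fun ξ d => by
  rw [smul_apply, toOp_vec, toOp_vec, smul_def]
  simp only [rightInner_csmul_left, star_star, smul_mul_assoc, csmul_comm_right,
    EquivalenceBimodule.csmul_smul_left, ← smul_add]
  rfl

instance : AddCommGroup (Linking A X) :=
  Function.Injective.addCommGroup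
    (fun m : Linking A X => ((m.a, m.x), (m.y, m.b)))
    (fun m n h => by
      simp only [Prod.mk.injEq] at h
      exact Linking.ext h.1.1 h.1.2 h.2.1 h.2.2)
    rfl (fun _ _ => rfl) (fun _ => rfl) (fun _ _ => rfl) (fun _ _ => rfl) (fun _ _ => rfl)

/-- `toOp` as an additive map. -/
noncomputable def toOpAdd : Linking A X →+ (Space A X →L[ℂ] Space A X) where
  toFun := toOp
  map_zero' := toOp_zero
  map_add' := toOp_add

lemma toOp_neg (m : Linking A X) : (-m).toOp = -m.toOp := map_neg toOpAdd m
lemma toOp_sub (m n : Linking A X) : (m - n).toOp = m.toOp - n.toOp := map_sub toOpAdd m n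
lemma toOp_nsmul (k : ℕ) (m : Linking A X) : (k • m).toOp = k • m.toOp := map_nsmul toOpAdd k m
lemma toOp_zsmul (k : ℤ) (m : Linking A X) : (k • m).toOp = k • m.toOp := map_zsmul toOpAdd k m

lemma toOp_pow (m : Linking A X) (k : ℕ) : (m ^ k).toOp = m.toOp ^ k := by
  induction k with
  | zero => exact toOp_one.trans (pow_zero _).symm
  | succ k ih => rw [pow_succ, ← ih, ← toOp_mul]; rfl

lemma toOp_natCast (k : ℕ) : (k : Linking A X).toOp = k := by
  have h : (k : Linking A X) = k • (1 : Linking A X) := by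
    refine Linking.ext ?_ ?_ ?_ ?_
    · exact (nsmul_one k).symm
    · exact (nsmul_zero k).symm
    · exact (nsmul_zero k).symm
    · exact (nsmul_one k).symm
  rw [h, toOp_nsmul, toOp_one, nsmul_one]

lemma toOp_intCast (k : ℤ) : (k : Linking A X).toOp = k := by
  have h : (k : Linking A X) = k • (1 : Linking A X) := by
    refine Linking.ext ?_ ?_ ?_ ?_
    · exact (zsmul_one k).symm
    · exact (zsmul_zero k).symm
    · exact (zsmul_zero k).symm
    · exact (zsmul_one k).symm
  rw [h, toOp_zsmul, toOp_one, zsmul_one]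

noncomputable instance : Ring (Linking A X) :=
  Function.Injective.ring toOp toOp_injective toOp_zero toOp_one toOp_add toOp_mul toOp_neg toOp_sub
    toOp_nsmul toOp_zsmul toOp_pow toOp_natCast toOp_intCast

noncomputable instance : Module ℂ (Linking A X) :=
  Function.Injective.module ℂ toOpAdd toOp_injective toOp_smul

noncomputable instance : Algebra ℂ (Linking A X) :=
  Algebra.ofModule
    (fun c m n => toOp_injective (by
      rw [toOp_mul, toOp_smul, toOp_smul, toOp_mul]; rfl))
    (fun c m n => toOp_injective (by
      rw [toOp_mul, toOp_smul, toOp_smul, toOp_mul]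
      exact ContinuousLinearMap.ext fun p => map_smul m.toOp c (n.toOp p)))

instance : StarRing (Linking A X) where
  star_involutive m := by simp [star_def]
  star_mul m n := by
    simp only [star_def, mul_def, star_add, star_mul, star_star, star_leftInner, star_rightInner,
      add_comm]
  star_add m n := by simp [star_def, add_def]

instance : StarModule ℂ (Linking A X) where
  star_smul c m := by simp [star_def, smul_def]

/-- The representation of the linking algebra on the Hilbert module `X ⊕ A`. -/
noncomputable def toOpHom : Linking A X →ₐ[ℂ] (Space A X →L[ℂ] Space A X) where
  toFun := toOp
  map_one' := toOp_one
  map_mul' := toOp_mul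
  map_zero' := toOp_zero
  map_add' := toOp_add
  commutes' c := by
    rw [Algebra.algebraMap_eq_smul_one, toOp_smul, toOp_one, Algebra.algebraMap_eq_smul_one]

/-- The norm of the linking algebra is the operator norm on the Hilbert module `X ⊕ A`. -/
noncomputable instance : NormedRing (Linking A X) :=
  NormedRing.induced (Linking A X) (Space A X →L[ℂ] Space A X) toOpHom toOp_injective

noncomputable instance : NormedAlgebra ℂ (Linking A X) :=
  NormedAlgebra.induced ℂ (Linking A X) (Space A X →L[ℂ] Space A X) toOpHom

lemma norm_def (m : Linking A X) : ‖m‖ = ‖m.toOp‖ := rfl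

lemma vec_fst (x : X) (a : A) : (vec x a : Space A X).1 = x := rfl
lemma vec_snd (x : X) (a : A) : (vec x a : Space A X).2 = a := rfl

lemma inner_toOp (m : Linking A X) (p q : Space A X) :
    inner Aᵐᵒᵖ (m.toOp p) q = inner Aᵐᵒᵖ p ((star m).toOp q) := by
  apply unop_injective
  change rightInner (m.a • p.1 + op p.2 • m.x) q.1 + star (rightInner m.y p.1 + m.b * p.2) * q.2 =
    rightInner p.1 (star m.a • q.1 + op q.2 • m.y) + star p.2 * (rightInner m.x q.1 + star m.b * q.2)
  simp only [rightInner_add_left, rightInner_add_right, rightInner_smul_adjoint,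
    rightInner_smul_left, rightInner_smul_right, star_add, star_mul, star_rightInner, mul_add,
    add_mul, mul_assoc]
  abel

instance : CStarRing (Linking A X) where
  norm_mul_self_le m := by
    have key : ‖m.toOp‖ ≤ √‖(star m * m).toOp‖ := by
      refine ContinuousLinearMap.opNorm_le_bound _ (Real.sqrt_nonneg _) fun p => ?_
      refine (abs_le_of_sq_le_sq' ?_ (by positivity)).2
      rw [mul_pow, Real.sq_sqrt (ContinuousLinearMap.opNorm_nonneg _),
        CStarModule.norm_sq_eq Aᵐᵒᵖ, inner_toOp]
      calc ‖inner Aᵐᵒᵖ p ((star m).toOp (m.toOp p))‖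
          ≤ ‖p‖ * ‖(star m).toOp (m.toOp p)‖ := CStarModule.norm_inner_le _
        _ = ‖p‖ * ‖(star m * m).toOp p‖ := by rw [toOp_mul]; rfl
        _ ≤ ‖p‖ * (‖(star m * m).toOp‖ * ‖p‖) := by
            gcongr; exact ContinuousLinearMap.le_opNorm _ _
        _ = ‖(star m * m).toOp‖ * ‖p‖ ^ 2 := by ring
    have h0 : 0 ≤ ‖m.toOp‖ := ContinuousLinearMap.opNorm_nonneg _
    calc ‖m‖ * ‖m‖ = ‖m.toOp‖ ^ 2 := by rw [norm_def]; ring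
      _ ≤ √‖(star m * m).toOp‖ ^ 2 := by gcongr
      _ = ‖star m * m‖ := by rw [Real.sq_sqrt (ContinuousLinearMap.opNorm_nonneg _), norm_def]

variable (A X) in
/-- The four entries of a matrix. -/
def entries : Linking A X ≃+ A × X × X × A where
  toFun m := (m.a, m.x, m.y, m.b)
  invFun p := ⟨p.1, p.2.1, p.2.2.1, p.2.2.2⟩
  left_inv _ := rfl
  right_inv _ := rfl
  map_add' _ _ := rfl

lemma norm_fst_le_norm (p : Space A X) : ‖p.1‖ ≤ ‖p‖ :=
  (le_max_left _ _).trans (WithCStarModule.max_le_prod_norm p)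

lemma norm_snd_le_norm (p : Space A X) : ‖p.2‖ ≤ ‖p‖ :=
  (le_max_right _ _).trans (WithCStarModule.max_le_prod_norm p)

lemma norm_vec_le (x : X) (a : A) : ‖(vec x a : Space A X)‖ ≤ ‖x‖ + ‖a‖ :=
  WithCStarModule.prod_norm_le_norm_add _

lemma norm_le_entries (m : Linking A X) : ‖m‖ ≤ 4 * ‖entries A X m‖ := by
  have ha : ‖m.a‖ ≤ ‖entries A X m‖ := norm_fst_le (entries A X m)
  have hx : ‖m.x‖ ≤ ‖entries A X m‖ :=
    (norm_fst_le (entries A X m).2).trans (norm_snd_le (entries A X m))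
  have hy : ‖m.y‖ ≤ ‖entries A X m‖ :=
    (norm_fst_le (entries A X m).2.2).trans
      ((norm_snd_le (entries A X m).2).trans (norm_snd_le (entries A X m)))
  have hb : ‖m.b‖ ≤ ‖entries A X m‖ :=
    (norm_snd_le (entries A X m).2.2).trans
      ((norm_snd_le (entries A X m).2).trans (norm_snd_le (entries A X m)))
  set N := ‖entries A X m‖
  have hN : 0 ≤ N := norm_nonneg _
  rw [norm_def]
  refine ContinuousLinearMap.opNorm_le_bound _ (by positivity) fun p => ?_
  have h1 := norm_fst_le_norm p
  have h2 := norm_snd_le_norm p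
  calc ‖m.toOp p‖ ≤ ‖m.a • p.1 + op p.2 • m.x‖ + ‖rightInner m.y p.1 + m.b * p.2‖ :=
        norm_vec_le _ _
    _ ≤ (‖m.a‖ * ‖p.1‖ + ‖m.x‖ * ‖p.2‖) + (‖m.y‖ * ‖p.1‖ + ‖m.b‖ * ‖p.2‖) :=
        add_le_add
          ((norm_add_le _ _).trans (add_le_add (norm_smul_le_left _ _) (norm_smul_le_right _ _)))
          ((norm_add_le _ _).trans (add_le_add (norm_rightInner_le _ _) (norm_mul_le _ _)))
    _ ≤ (N * ‖p‖ + N * ‖p‖) + (N * ‖p‖ + N * ‖p‖) := by gcongr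
    _ = 4 * N * ‖p‖ := by ring

lemma exists_entries_le : ∃ K : NNReal, ∀ m : Linking A X, ‖entries A X m‖ ≤ K * ‖m‖ := by
  obtain ⟨C, hC0, hC⟩ := exists_bound_left (A := A) (X := X)
  have hop (m : Linking A X) (x : X) (a : A) : ‖m.toOp (vec x a)‖ ≤ ‖m‖ * (‖x‖ + ‖a‖) :=
    (ContinuousLinearMap.le_opNorm _ _).trans
      (mul_le_mul_of_nonneg_left (norm_vec_le _ _) (norm_nonneg _))
  have hfst (m : Linking A X) (x : X) (a : A) :
      ‖m.a • x + op a • m.x‖ ≤ ‖m‖ * (‖x‖ + ‖a‖) := (norm_fst_le_norm _).trans (hop m x a)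
  have hsnd (m : Linking A X) (x : X) (a : A) :
      ‖rightInner m.y x + m.b * a‖ ≤ ‖m‖ * (‖x‖ + ‖a‖) := (norm_snd_le_norm _).trans (hop m x a)
  refine ⟨⟨C + ‖(1 : A)‖ + 1, by positivity⟩, fun m => ?_⟩
  change _ ≤ (C + ‖(1 : A)‖ + 1) * ‖m‖
  have hm : 0 ≤ ‖m‖ := norm_nonneg m
  have h1 : 0 ≤ ‖(1 : A)‖ := norm_nonneg _
  have hCm := mul_nonneg hC0 hm
  have h1m := mul_nonneg h1 hm
  have ha : ‖m.a‖ ≤ C * ‖m‖ := hC _ _ hm fun x => by simpa using hfst m x 0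
  have hx : ‖m.x‖ ≤ ‖m‖ * ‖(1 : A)‖ := by simpa using hfst m 0 1
  have hb : ‖m.b‖ ≤ ‖m‖ * ‖(1 : A)‖ := by simpa [rightInner] using hsnd m 0 1
  have hy : ‖m.y‖ ≤ ‖m‖ := by
    have h := hsnd m m.y 0
    rw [mul_zero, add_zero, norm_zero, add_zero, rightInner, norm_unop,
      ← CStarModule.norm_sq_eq Aᵐᵒᵖ, sq] at h
    rcases (norm_nonneg m.y).eq_or_lt with h0 | h0
    · rw [← h0]; exact hm
    · exact le_of_mul_le_mul_right h h0
  refine max_le ?_ (max_le ?_ (max_le ?_ ?_))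
  · change ‖m.a‖ ≤ _; linarith
  · change ‖m.x‖ ≤ _; linarith
  · change ‖m.y‖ ≤ _; linarith
  · change ‖m.b‖ ≤ _; linarith

lemma entries_isUniformEmbedding : IsUniformEmbedding (entries A X) := by
  obtain ⟨K, hK⟩ := exists_entries_le (A := A) (X := X)
  have hl : LipschitzWith K (entries A X) :=
    AddMonoidHomClass.lipschitz_of_bound_nnnorm (entries A X) K hK
  have ha : AntilipschitzWith 4 (entries A X) :=
    AddMonoidHomClass.antilipschitz_of_bound (entries A X) norm_le_entries
  exact ha.isUniformEmbedding hl.uniformContinuous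

/-- The matrices form a complete space, so no closure has to be taken. -/
instance : CompleteSpace (Linking A X) := by
  have : CompleteSpace X := EquivalenceBimodule.toCompleteSpace A
  exact (completeSpace_congr (e := (entries A X).toEquiv) entries_isUniformEmbedding).2 inferInstance

/-- The linking algebra is a unital `C*`-algebra. -/
noncomputable instance : CStarAlgebra (Linking A X) where

variable (A X) in
/-- The diagonal copy of `A` in the linking algebra. -/
def diag : Set (Linking A X) := {m | ∃ a : A, m = ⟨a, 0, 0, a⟩}

end Linking

section IndexTwo

variable {A : Type u} {X : Type v} [CStarAlgebra A] [PartialOrder A] [StarOrderedRing A]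
  [NormedAddCommGroup X] [NormedSpace ℂ X] [Module A X] [Module Aᵐᵒᵖ X]
  [CStarModule A X] [CStarModule Aᵐᵒᵖ X] [EquivalenceBimodule A X]

/-- The algebra `B_X` of an involutive equivalence bimodule `X`: all the matrices in the linking
algebra with rows `(a, x)` and `((x♯)~, a)`. -/
def indexTwoAlgebra (J : Involution A X) : StarSubalgebra ℂ (Linking A X) where
  carrier := {m | ∃ (a : A) (x : X), m = ⟨a, x, J.sharp x, a⟩}
  mul_mem' := by
    rintro _ _ ⟨a, x, rfl⟩ ⟨b, y, rfl⟩
    refine ⟨a * b + leftInner x (J.sharp y), a • y + op b • x, Linking.ext rfl rfl ?_ ?_⟩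
    · have h1 := J.sharp_bimodule a 1 y
      have h2 := J.sharp_bimodule 1 b x
      simp only [op_one, star_one, one_smul] at h1 h2
      simp only [Linking.mul_def, J.sharp_add, h1, h2, add_comm]
    · simp only [Linking.mul_def, J.leftInner_sharp, add_comm]
  add_mem' := by
    rintro _ _ ⟨a, x, rfl⟩ ⟨b, y, rfl⟩
    exact ⟨a + b, x + y, by rw [Linking.add_def, J.sharp_add]⟩
  algebraMap_mem' c := by
    refine ⟨c • 1, c • 0, ?_⟩
    rw [Algebra.algebraMap_eq_smul_one, Linking.smul_def, Linking.one_def, J.sharp_smul]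
    have h : J.sharp 0 = 0 := by simpa using J.sharp_smul 0 0
    rw [h]
  star_mem' := by
    rintro _ ⟨a, x, rfl⟩
    exact ⟨star a, J.sharp x, by rw [Linking.star_def, J.sharp_sharp]⟩

/-- `B_X` is closed in the linking algebra. -/
instance indexTwoAlgebra_isClosed (J : Involution A X) :
    IsClosed (indexTwoAlgebra J : Set (Linking A X)) := by
  have hJ : Continuous J.sharp := by
    have h (x : X) : ‖J.sharp x‖ ≤ 1 * ‖x‖ := by
      have h2 := J.leftInner_sharp x (J.sharp x)
      rw [J.sharp_sharp] at h2
      rw [one_mul, ← sq_le_sq₀ (norm_nonneg _) (norm_nonneg _), CStarModule.norm_sq_eq Aᵐᵒᵖ,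
        CStarModule.norm_sq_eq A, ← norm_unop]
      exact (congrArg norm h2).ge
    exact AddMonoidHomClass.continuous_of_bound
      (AddMonoidHom.mk' J.sharp J.sharp_add) 1 h
  have he : Continuous (Linking.entries A X) :=
    Linking.entries_isUniformEmbedding.uniformContinuous.continuous
  have hset : (indexTwoAlgebra J : Set (Linking A X)) =
      {m | (Linking.entries A X m).2.2.2 = (Linking.entries A X m).1} ∩
        {m | (Linking.entries A X m).2.2.1 = J.sharp (Linking.entries A X m).2.1} := by
    ext m
    constructor
    · rintro ⟨a, x, rfl⟩
      exact ⟨rfl, rfl⟩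
    · rintro ⟨h1, h2⟩
      exact ⟨m.a, m.x, Linking.ext rfl rfl h2 h1⟩
  rw [hset]
  exact (isClosed_eq he.snd.snd.snd he.fst).inter (isClosed_eq he.snd.snd.fst (hJ.comp he.snd.fst))

end IndexTwo

/-! ### The bimodule of a `2ℤ`-inner dynamical system -/

/-- The vector space `A` with the left action of `A` by multiplication, the right action
`x · a = x α(a)` and the inner products `x y*` (left) and `α⁻¹(x* y)` (right). -/
def TwistedBimodule {A : Type u} [CStarAlgebra A] (_ : A ≃⋆ₐ[ℂ] A) : Type u := A

namespace TwistedBimodule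

variable {A : Type u} [CStarAlgebra A] (α : A ≃⋆ₐ[ℂ] A)

noncomputable instance : NormedAddCommGroup (TwistedBimodule α) :=
  inferInstanceAs (NormedAddCommGroup A)
noncomputable instance : NormedSpace ℂ (TwistedBimodule α) := inferInstanceAs (NormedSpace ℂ A)
noncomputable instance : Module A (TwistedBimodule α) := inferInstanceAs (Module A A)

/-- An element of `A`, viewed in the bimodule. -/
def of (a : A) : TwistedBimodule α := a
variable {α} in
/-- An element of the bimodule, viewed in `A`. -/
def val (x : TwistedBimodule α) : A := x

noncomputable instance : Module Aᵐᵒᵖ (TwistedBimodule α) where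
  smul a x := of α (val x * α (unop a))
  one_smul x := show val x * α 1 = val x by rw [map_one, mul_one]
  mul_smul a b x := show val x * α (unop b * unop a) = val x * α (unop b) * α (unop a) by
    rw [map_mul, mul_assoc]
  smul_zero a := show 0 * α (unop a) = 0 from zero_mul _
  smul_add a x y := show (val x + val y) * α (unop a) = _ from add_mul _ _ _
  add_smul a b x := show val x * α (unop a + unop b) = val x * α (unop a) + val x * α (unop b) by
    rw [map_add, mul_add]
  zero_smul x := show val x * α 0 = 0 by rw [map_zero, mul_zero]

variable [PartialOrder A] [StarOrderedRing A]

noncomputable instance : CStarModule A (TwistedBimodule α) where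
  inner x y := val y * star (val x)
  inner_add_right {x y z} := add_mul (val y) (val z) (star (val x))
  inner_self_nonneg {x} := mul_star_self_nonneg (val x)
  inner_self {x} := CStarRing.mul_star_self_eq_zero_iff (val x)
  inner_op_smul_right {a x y} := mul_assoc a (val y) (star (val x))
  inner_smul_right_complex {c x y} := smul_mul_assoc c (val y) (star (val x))
  star_inner x y := show star (val y * star (val x)) = val x * star (val y) by
    rw [star_mul, star_star]
  norm_eq_sqrt_norm_inner_self x := show ‖val x‖ = √‖val x * star (val x)‖ by
    rw [CStarRing.norm_self_mul_star, Real.sqrt_mul_self (norm_nonneg _)]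

noncomputable instance : CStarModule Aᵐᵒᵖ (TwistedBimodule α) where
  inner x y := op (α.symm (star (val x) * val y))
  inner_add_right {x y z} := show op (α.symm (star (val x) * (val y + val z))) =
      op (α.symm (star (val x) * val y)) + op (α.symm (star (val x) * val z)) by
    rw [mul_add, map_add, op_add]
  inner_self_nonneg {x} := show (0 : A) ≤ α.symm (star (val x) * val x) by
    rw [map_mul, map_star]; exact star_mul_self_nonneg _
  inner_self {x} := by
    rw [op_eq_zero_iff, EmbeddingLike.map_eq_zero_iff]
    exact CStarRing.star_mul_self_eq_zero_iff (val x)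
  inner_op_smul_right {a x y} := show op (α.symm (star (val x) * (val y * α (unop a)))) =
      op (unop a) * op (α.symm (star (val x) * val y)) by
    rw [← mul_assoc, map_mul, StarAlgEquiv.symm_apply_apply, op_mul]
  inner_smul_right_complex {c x y} := show op (α.symm (star (val x) * (c • val y))) =
      c • op (α.symm (star (val x) * val y)) by
    rw [mul_smul_comm, map_smul, op_smul]
  star_inner x y := show op (star (α.symm (star (val x) * val y))) =
      op (α.symm (star (val y) * val x)) by
    rw [← map_star, star_mul, star_star]
  norm_eq_sqrt_norm_inner_self x := show ‖val x‖ = √‖op (α.symm (star (val x) * val x))‖ by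
    rw [norm_op, StarAlgEquiv.norm_map, CStarRing.norm_star_mul_self,
      Real.sqrt_mul_self (norm_nonneg _)]

lemma left_smul_def (a : A) (x : TwistedBimodule α) : a • x = of α (a * val x) := rfl
lemma right_smul_def (a : A) (x : TwistedBimodule α) : op a • x = of α (val x * α a) := rfl
lemma leftInner_def (x y : TwistedBimodule α) : leftInner x y = val x * star (val y) := rfl
lemma rightInner_def (x y : TwistedBimodule α) :
    rightInner x y = α.symm (star (val x) * val y) := rfl

instance : EquivalenceBimodule A (TwistedBimodule α) where
  toCompleteSpace := inferInstanceAs (CompleteSpace A)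
  smul_comm a b x := (mul_assoc a (val x) (α (unop b))).symm
  csmul_smul_left c a x := smul_mul_assoc c a (val x)
  csmul_smul_right c a x := show val x * α (c • a) = c • (val x * α a) by
    rw [map_smul, mul_smul_comm]
  left_full := by
    refine Set.eq_univ_of_forall fun a => subset_closure (Submodule.subset_span ?_)
    exact ⟨of α a, of α 1, show a * star 1 = a by rw [star_one, mul_one]⟩
  right_full := by
    refine Set.eq_univ_of_forall fun a => subset_closure (Submodule.subset_span ?_)
    exact ⟨of α 1, of α (α a), show α.symm (star 1 * α a) = a by
      rw [star_one, one_mul, StarAlgEquiv.symm_apply_apply]⟩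
  leftInner_smul x y w :=
    show val x * star (val y) * val w = val x * α (α.symm (star (val y) * val w)) by
      rw [StarAlgEquiv.apply_symm_apply, mul_assoc]

end TwistedBimodule

/-- The `C*`-dynamical system `(A, ℤ, α)` generated by the automorphism `α` is `2ℤ`-inner, and this
is witnessed by the unitary `z`: `α(z) = z` and `α² = Ad z`. -/
structure IsTwoZInner {A : Type u} [CStarAlgebra A] (α : A ≃⋆ₐ[ℂ] A) (z : A) : Prop where
  mem_unitary : z ∈ unitary A
  map_eq : α z = z
  sq_eq_ad (a : A) : α (α a) = z * a * star z

/-- The involution `x♯ = z* α(x*)`. -/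
def twistedInvolution {A : Type u} [CStarAlgebra A] [PartialOrder A] [StarOrderedRing A]
    {α : A ≃⋆ₐ[ℂ] A} {z : A} (h : IsTwoZInner α z) : Involution A (TwistedBimodule α) where
  sharp x := .of α (star z * α (star x.val))
  sharp_add x y := show star z * α (star (x.val + y.val)) =
      star z * α (star x.val) + star z * α (star y.val) by
    rw [star_add, map_add, mul_add]
  sharp_smul c x := show star z * α (star (c • x.val)) = star c • (star z * α (star x.val)) by
    rw [star_smul, map_smul, mul_smul_comm]
  sharp_sharp x := show star z * α (star (star z * α (star x.val))) = x.val by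
    rw [star_mul, star_star, map_mul, ← map_star, star_star, h.sq_eq_ad, h.map_eq]
    simp only [mul_assoc, Unitary.star_mul_self_of_mem h.mem_unitary, mul_one]
    rw [← mul_assoc, Unitary.star_mul_self_of_mem h.mem_unitary, one_mul]
  sharp_bimodule a b x := show star z * α (star (a * x.val * α b)) =
      star b * (star z * α (star x.val)) * α (star a) by
    rw [star_mul, star_mul, ← map_star, map_mul, h.sq_eq_ad, map_mul]
    simp only [← mul_assoc]
    rw [Unitary.star_mul_self_of_mem h.mem_unitary, one_mul]
  leftInner_sharp x y := show x.val * star (star z * α (star y.val)) =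
      α.symm (star (star z * α (star x.val)) * y.val) by
    apply EquivLike.injective α
    rw [StarAlgEquiv.apply_symm_apply, star_mul, star_mul, star_star, ← map_star, ← map_star,
      star_star, star_star, map_mul, map_mul, h.sq_eq_ad, h.map_eq]
    simp only [mul_assoc, Unitary.star_mul_self_of_mem h.mem_unitary, mul_one]

/-- A unital `C*`-algebra is simple if it is nonzero and its only closed two-sided ideals are `0`
and the whole algebra. -/
def IsSimpleCStarAlgebra (B : Type u) [CStarAlgebra B] : Prop :=
  Nontrivial B ∧ ∀ I : TwoSidedIdeal B, IsClosed (I : Set B) → I = ⊥ ∨ I = ⊤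

/-- The automorphism `α` is outer: it is not of the form `Ad w` for a unitary `w`. -/
def IsOuter {A : Type u} [CStarAlgebra A] (α : A ≃⋆ₐ[ℂ] A) : Prop :=
  ¬ ∃ w ∈ unitary A, ∀ a : A, α a = w * a * star w

end BimoduleIndexTwo

/-! Let `u` be the element of `B` with diagonal entry 0 and upper right entry 1. Then `B = A + Au`,
with `u b = α(b) u` and `u² = z` (`crossed_mul`): `B` is a twisted crossed product of `A` by the
group of order two, and every element is uniquely `a + x u`.

Everything rests on a Schur-type dichotomy, `not_isOuter_of_intertwiner`. If `α(b) x = x b` for all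
`b`, then `x* x` and `x x*` are central in the simple algebra `A`, hence scalars, and a nonzero `x`
rescales to a unitary implementing `α`. So for outer `α` every intertwiner vanishes.

For outer `α`, a matrix commuting with `A` has central diagonal entries and intertwiners off the
diagonal, so it is diagonal with scalar entries; membership in `B`, or commutation with `u`, makes
the two scalars equal. For simplicity, a nonzero ideal that meets `A` in 0 would contain some `a +
u`; then `α(b)(a + u) - (a + u) b` lies in `A`, hence vanishes, so `a` is an intertwiner and is 0.
Now `u`, and with it the unitary `u² = z`, lies in the ideal, which is absurd.

Conversely, if `α = Ad w`, then `w* u` is a non-scalar central element of `B`. It refutes both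
commutant conditions, and also simplicity, since the centre of a simple unital algebra is scalar. -/

namespace BimoduleIndexTwo

open MulOpposite

/-! ### Ideals, centre and intertwiners in a simple unital algebra -/

section Simple

variable {A : Type*} [CStarAlgebra A]

/-- A simple unital `C*`-algebra is simple as a ring. -/
lemma IsSimpleCStarAlgebra.one_mem (hA : IsSimpleCStarAlgebra A) (J : TwoSidedIdeal A) {x : A}
    (hx : x ∈ J) (hx0 : x ≠ 0) : (1 : A) ∈ J := by
  have hzero : (0 : A) ∈ closure (J : Set A) := subset_closure J.zero_mem
  let K : TwoSidedIdeal A := .mk' (closure (J : Set A)) hzero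
    (fun hx hy => map_mem_closure₂ continuous_add hx hy fun _ ha _ hb => J.add_mem ha hb)
    (fun hx => map_mem_closure continuous_neg hx fun _ ha => J.neg_mem ha)
    (fun {x _} hy => map_mem_closure (f := (x * ·)) (continuous_const_mul x) hy fun _ ha => J.mul_mem_left _ _ ha)
    (fun {_ y} hx => map_mem_closure (f := (· * y)) (continuous_mul_const y) hx fun _ ha => J.mul_mem_right _ _ ha)
  have hKJ : (K : Set A) = closure (J : Set A) := TwoSidedIdeal.coe_mk' ..
  have hxK : x ∈ (K : Set A) := hKJ ▸ subset_closure hx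
  have hK : K = ⊤ := (hA.2 K (hKJ ▸ isClosed_closure)).resolve_left fun hbot => by
    rw [SetLike.mem_coe, hbot, TwoSidedIdeal.mem_bot] at hxK
    exact hx0 hxK
  have h1 : (1 : A) ∈ closure (J : Set A) := by
    rw [← hKJ, SetLike.mem_coe, hK]
    trivial
  -- An element of `J` at distance less than 1 from 1 is invertible, so `J` itself already contains
  -- 1.
  obtain ⟨s, hs, h⟩ := Metric.mem_closure_iff.1 h1 1 one_pos
  rw [dist_eq_norm] at h
  obtain ⟨u, hu⟩ := isUnit_one_sub_of_norm_lt_one h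
  rw [sub_sub_cancel] at hu
  rw [← u.inv_mul, hu]
  exact J.mul_mem_left _ _ hs

/-- The centre of a simple unital `C*`-algebra consists of the scalars. -/
lemma IsSimpleCStarAlgebra.exists_eq_algebraMap (hA : IsSimpleCStarAlgebra A) {a : A}
    (ha : ∀ b, a * b = b * a) : ∃ c : ℂ, a = algebraMap ℂ A c := by
  have := hA.1
  obtain ⟨c, hc⟩ := spectrum.nonempty a
  refine ⟨c, ?_⟩
  set d := algebraMap ℂ A c - a with hd
  have hdc (b : A) : d * b = b * d := by rw [hd, sub_mul, mul_sub, ha, Algebra.commutes]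
  -- Since `d` is central, `dA` is a two-sided ideal. If `d ≠ 0`, it contains 1, so `d` is
  -- invertible, against the choice of `c` in the spectrum of `a`.
  let J : TwoSidedIdeal A := .mk' (Set.range (d * ·)) ⟨0, mul_zero d⟩
    (by rintro _ _ ⟨x, rfl⟩ ⟨y, rfl⟩; exact ⟨x + y, mul_add ..⟩)
    (by rintro _ ⟨x, rfl⟩; exact ⟨-x, mul_neg ..⟩)
    (by rintro x _ ⟨y, rfl⟩; exact ⟨x * y, by simp only [← mul_assoc, hdc]⟩)
    (by rintro _ y ⟨x, rfl⟩; exact ⟨x * y, (mul_assoc ..).symm⟩)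
  by_contra hne
  have h1 : (1 : A) ∈ J := hA.one_mem J (x := d) ((TwoSidedIdeal.mem_mk' ..).2 ⟨1, mul_one d⟩)
    fun h0 => hne (sub_eq_zero.1 h0).symm
  obtain ⟨e, he⟩ := (TwoSidedIdeal.mem_mk' ..).1 h1
  exact hc ⟨⟨d, e, he, (hdc e).symm.trans he⟩, rfl⟩

/-- In a simple unital `C*`-algebra, a nonzero intertwiner between the identity and `α` is a multiple
of a unitary that implements `α`. -/
lemma not_isOuter_of_intertwiner (hA : IsSimpleCStarAlgebra A) {α : A ≃⋆ₐ[ℂ] A} {x : A}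
    (hx0 : x ≠ 0) (hx : ∀ b, α b * x = x * b) : ¬ IsOuter α := by
  have := hA.1
  have hx' (b : A) : star x * α b = b * star x := by
    have := congrArg star (hx (star b))
    rwa [star_mul, star_mul, ← map_star, star_star] at this
  -- `x` carries `b` to `α(b)` and `x*` carries it back, so `x* x` commutes with `A` and `x x*` with
  -- `α(A) = A`.
  obtain ⟨c, hc⟩ := hA.exists_eq_algebraMap (a := star x * x) fun b => by
    rw [mul_assoc, ← hx, ← mul_assoc, hx', mul_assoc]
  obtain ⟨d, hd⟩ := hA.exists_eq_algebraMap (a := x * star x) fun b => by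
    obtain ⟨b, rfl⟩ := EquivLike.surjective α b
    rw [mul_assoc, hx', ← mul_assoc, ← hx, mul_assoc]
  -- Both scalars describe `x x* x`.
  have hcd : d = c := by
    have h : d • x = c • x := by
      rw [Algebra.smul_def, ← hd, mul_assoc, hc, ← Algebra.commutes, ← Algebra.smul_def]
    exact smul_left_injective ℂ hx0 h
  subst d
  obtain ⟨t, ht, rfl⟩ : ∃ t : ℝ, 0 < t ∧ (t : ℂ) = c := by
    have hsa : star c = c := by
      apply (algebraMap ℂ A).injective
      rw [algebraMap_star_comm, ← hc, star_mul, star_star]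
    obtain ⟨t, rfl⟩ := Complex.conj_eq_iff_real.1 hsa
    have hmap : star x * x = algebraMap ℝ A t := hc
    refine ⟨t, lt_of_le_of_ne ?_ ?_, rfl⟩
    · have hsp : t ∈ spectrum ℝ (star x * x) := by
        rw [hmap, spectrum.scalar_eq]
        rfl
      exact spectrum_star_mul_self_nonneg t hsp
    · rintro rfl
      rw [map_zero, CStarRing.star_mul_self_eq_zero_iff] at hmap
      exact hx0 hmap
  -- As `x* x = x x* = t` with `t > 0`, the multiple of `x` by `t^(-1/2)` is unitary.
  obtain ⟨r, hr⟩ : ∃ r : ℝ, r * r * t = 1 := ⟨(√t)⁻¹, by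
    rw [← mul_inv, Real.mul_self_sqrt ht.le, inv_mul_cancel₀ ht.ne']⟩
  have hr : (r : ℂ) * r * t = 1 := mod_cast hr
  have hss : star (r : ℂ) = r := Complex.conj_ofReal r
  have h1 : star ((r : ℂ) • x) * ((r : ℂ) • x) = 1 := by
    rw [star_smul, smul_mul_smul_comm, hss, hc, Algebra.algebraMap_eq_smul_one, smul_smul, hr,
      one_smul]
  have h2 : ((r : ℂ) • x) * star ((r : ℂ) • x) = 1 := by
    rw [star_smul, smul_mul_smul_comm, hss, hd, Algebra.algebraMap_eq_smul_one, smul_smul, hr,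
      one_smul]
  refine fun hout => hout ⟨(r : ℂ) • x, Unitary.mem_iff.2 ⟨h1, h2⟩, fun b => ?_⟩
  rw [smul_mul_assoc, ← hx, ← mul_smul_comm, mul_assoc, h2, mul_one]

end Simple

/-! ### The algebra `B` as a twisted crossed product -/

section Crossed

variable {A : Type*} [CStarAlgebra A] [PartialOrder A] [StarOrderedRing A]
  {α : A ≃⋆ₐ[ℂ] A} {z : A} (h : IsTwoZInner α z)

/-- The element `a + x u` of the algebra `B`, where `u` is the unitary that implements `α`. -/
def crossed (a x : A) : indexTwoAlgebra (twistedInvolution h) :=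
  ⟨⟨a, .of α x, (twistedInvolution h).sharp (.of α x), a⟩, a, .of α x, rfl⟩

lemma exists_eq_crossed (m : indexTwoAlgebra (twistedInvolution h)) :
    ∃ a x, m = crossed h a x := by
  obtain ⟨_, a, x, rfl⟩ := m
  exact ⟨a, x, rfl⟩

lemma crossed_inj {a x b y : A} : crossed h a x = crossed h b y ↔ a = b ∧ x = y := by
  refine ⟨fun H => ?_, fun H => by rw [H.1, H.2]⟩
  have H' := congrArg Subtype.val H
  exact ⟨congrArg Linking.a H', congrArg Linking.x H'⟩

lemma crossed_zero : crossed h 0 0 = 0 := by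
  refine Subtype.ext (Linking.ext rfl rfl ?_ rfl)
  change star z * α (star 0) = 0
  rw [star_zero, map_zero, mul_zero]

lemma crossed_scalar (c : ℂ) : crossed h (algebraMap ℂ A c) 0 = algebraMap ℂ _ c := by
  refine Subtype.ext ?_
  change _ = algebraMap ℂ (Linking A (TwistedBimodule α)) c
  rw [Algebra.algebraMap_eq_smul_one, Algebra.algebraMap_eq_smul_one]
  refine Linking.ext rfl (smul_zero (A := A) c).symm ?_ rfl
  change star z * α (star 0) = star c • (0 : A)
  rw [star_zero, map_zero, mul_zero, smul_zero]

lemma crossed_one : crossed h 1 0 = 1 := by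
  simpa using crossed_scalar h 1

lemma crossed_add (a x b y : A) :
    crossed h a x + crossed h b y = crossed h (a + b) (x + y) := by
  refine Subtype.ext (Linking.ext rfl rfl ?_ rfl)
  exact ((twistedInvolution h).sharp_add (.of α x) (.of α y)).symm

/-- This encodes the relations `u b = α(b) u` and `u² = z`. The factor `z` comes from the
involution: the left inner product of `x` with `y♯` is `x (z* α(y*))* = x α(y) z`. -/
lemma crossed_mul (a x b y : A) : crossed h a x * crossed h b y =
    crossed h (a * b + x * α y * z) (a * y + x * α b) := by
  obtain ⟨c, w, hw⟩ := exists_eq_crossed h (crossed h a x * crossed h b y)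
  have H := congrArg Subtype.val hw
  have hc : a * b + x * star (star z * α (star y)) = c := congrArg Linking.a H
  have hv : a * y + x * α b = w := congrArg Linking.x H
  rw [hw, ← hc, ← hv, star_mul, star_star, ← map_star, star_star, mul_assoc]

end Crossed

/-! ### Commutants, simplicity of `B`, and the inner case -/

section Commutants

variable {A : Type*} [CStarAlgebra A] [PartialOrder A] [StarOrderedRing A]
  {α : A ≃⋆ₐ[ℂ] A} {z : A}

/-- The adjoint of `x` intertwines the identity and `α`. The relation is in the form in which it
arises for off-diagonal entries of matrices commuting with `A`. -/
lemma IsOuter.eq_zero (hout : IsOuter α) (hA : IsSimpleCStarAlgebra A) {x : A}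
    (hx : ∀ b, x * α b = b * x) : x = 0 := by
  by_contra hx0
  refine not_isOuter_of_intertwiner hA (star_ne_zero.2 hx0) (fun b => ?_) hout
  have := congrArg star (hx (star b))
  rwa [star_mul, star_mul, ← map_star, star_star] at this

/-- The entries of the matrices that commute with `A`. -/
lemma commutes_diag {m : Linking A (TwistedBimodule α)}
    (hm : m ∈ Set.centralizer (Linking.diag A (TwistedBimodule α))) (c : A) :
    m.a * c = c * m.a ∧ m.x.val * α c = c * m.x.val ∧ m.b * c = c * m.b := by
  have H := hm _ ⟨c, rfl⟩
  have ha : c * m.a + 0 * star m.y.val = m.a * c + m.x.val * star 0 := congrArg Linking.a H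
  have hx : c * m.x.val + 0 * α m.b = m.a * 0 + m.x.val * α c := congrArg Linking.x H
  have hb : α.symm (star 0 * m.x.val) + c * m.b = α.symm (star m.y.val * 0) + m.b * c :=
    congrArg Linking.b H
  simp only [star_zero, zero_mul, mul_zero, map_zero, add_zero, zero_add] at ha hx hb
  exact ⟨ha.symm, hx.symm, hb.symm⟩

lemma diag_subset (h : IsTwoZInner α z) : Linking.diag A (TwistedBimodule α) ⊆
    (indexTwoAlgebra (twistedInvolution h) : Set (Linking A (TwistedBimodule α))) := by
  rintro _ ⟨a, rfl⟩
  refine ⟨a, 0, Linking.ext rfl rfl ?_ rfl⟩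
  change 0 = star z * α (star 0)
  rw [star_zero, map_zero, mul_zero]

lemma centralizer_inter_eq_of_isOuter (hA : IsSimpleCStarAlgebra A) (h : IsTwoZInner α z)
    (hout : IsOuter α) :
    Set.centralizer (Linking.diag A (TwistedBimodule α)) ∩
      (indexTwoAlgebra (twistedInvolution h) : Set (Linking A (TwistedBimodule α))) =
      Set.range (algebraMap ℂ (Linking A (TwistedBimodule α))) := by
  ext m
  constructor
  · rintro ⟨hm, hB⟩
    obtain ⟨a, x, hax⟩ := exists_eq_crossed h ⟨m, hB⟩
    obtain rfl : m = (crossed h a x : Linking A (TwistedBimodule α)) := congrArg Subtype.val hax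
    obtain ⟨c, rfl⟩ := hA.exists_eq_algebraMap fun b => (commutes_diag hm b).1
    obtain rfl : x = 0 := hout.eq_zero hA fun b => (commutes_diag hm b).2.1
    exact ⟨c, (congrArg Subtype.val (crossed_scalar h c)).symm⟩
  · rintro ⟨c, rfl⟩
    exact ⟨fun _ _ => (Algebra.commutes c _).symm, algebraMap_mem _ c⟩

/-- Commutation with `A` alone makes the matrix diagonal but allows two different scalars on the
diagonal; it is `u` that forces them to agree. -/
lemma centralizer_eq_of_isOuter (hA : IsSimpleCStarAlgebra A) (h : IsTwoZInner α z)
    (hout : IsOuter α) :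
    Set.centralizer
      (indexTwoAlgebra (twistedInvolution h) : Set (Linking A (TwistedBimodule α))) =
      Set.range (algebraMap ℂ (Linking A (TwistedBimodule α))) := by
  ext m
  constructor
  · intro hm
    have hmd := commutes_diag (Set.centralizer_subset (diag_subset h) hm)
    -- The commutant of the self-adjoint set `B` is self-adjoint, and the upper right entry of `m*`
    -- is `m.y`, so the argument for the upper right corner also disposes of the lower left one.
    have hs : star m ∈ Set.centralizer
        (indexTwoAlgebra (twistedInvolution h) : Set (Linking A (TwistedBimodule α))) := by
      intro n hn
      have := congrArg star (hm (star n) (star_mem hn))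
      rw [star_mul, star_mul, star_star] at this
      exact this.symm
    have hsd := commutes_diag (Set.centralizer_subset (diag_subset h) hs)
    obtain ⟨c, hc⟩ := hA.exists_eq_algebraMap fun b => (hmd b).1
    have hx : m.x = TwistedBimodule.of α 0 := hout.eq_zero hA fun b => (hmd b).2.1
    have hy : m.y = TwistedBimodule.of α 0 := hout.eq_zero hA fun b => (hsd b).2.1
    -- The upper right entries of `u m = m u` give `α(m.b) = m.a`.
    have hu : (1 : A) * α m.b + 0 * m.x.val = m.a * 1 + m.x.val * α 0 :=
      (add_comm _ _).trans (congrArg Linking.x (hm _ (crossed h 0 1).2))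
    rw [map_zero, mul_zero, zero_mul, add_zero, add_zero, one_mul, mul_one, hc] at hu
    have hb : m.b = algebraMap ℂ A c := by
      apply EquivLike.injective α
      rw [hu, Algebra.algebraMap_eq_smul_one, map_smul, map_one]
    refine ⟨c, ?_⟩
    rw [Algebra.algebraMap_eq_smul_one] at hc hb ⊢
    refine Linking.ext hc.symm ?_ ?_ hb.symm
    · rw [hx]; exact smul_zero (A := A) c
    · rw [hy]; exact smul_zero (A := A) (star c)
  · rintro ⟨c, rfl⟩
    exact fun _ _ => (Algebra.commutes c _).symm

lemma isSimple_of_isOuter (hA : IsSimpleCStarAlgebra A) (h : IsTwoZInner α z)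
    (hout : IsOuter α) : IsSimpleCStarAlgebra (indexTwoAlgebra (twistedInvolution h)) := by
  have := hA.1
  refine ⟨⟨crossed h 0 0, crossed h 1 0, fun H => zero_ne_one ((crossed_inj h).1 H).1⟩,
    fun I _ => or_iff_not_imp_left.2 fun hI => ?_⟩
  have hleft (b : A) {a x : A} (H : crossed h a x ∈ I) : crossed h (b * a) (b * x) ∈ I := by
    simpa [crossed_mul] using I.mul_mem_left (crossed h b 0) _ H
  have hright (b : A) {a x : A} (H : crossed h a x ∈ I) : crossed h (a * b) (x * α b) ∈ I := by
    simpa [crossed_mul] using I.mul_mem_right _ (crossed h b 0) H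
  have hadd {a x b y : A} (H : crossed h a x ∈ I) (H' : crossed h b y ∈ I) :
      crossed h (a + b) (x + y) ∈ I := crossed_add h a x b y ▸ I.add_mem H H'
  have hneg {a x : A} (H : crossed h a x ∈ I) : crossed h (-a) (-x) ∈ I := by
    simpa using hleft (-1) H
  have hzero : crossed h 0 0 ∈ I := crossed_zero h ▸ I.zero_mem
  suffices h1 : crossed h 1 0 ∈ I by
    refine eq_top_iff.2 fun m _ => ?_
    obtain ⟨a, x, rfl⟩ := exists_eq_crossed h m
    have := I.mul_mem_left (crossed h a x) _ h1
    rwa [crossed_one, mul_one] at this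
  by_contra hI1
  -- `I ∩ A` is an ideal of the simple algebra `A` that does not contain 1, so it is 0.
  have hdiag {a : A} (ha : crossed h a 0 ∈ I) : a = 0 := by
    by_contra ha0
    let J : TwoSidedIdeal A := .mk' {a | crossed h a 0 ∈ I} hzero
      (fun H H' => by simpa using hadd H H') (fun H => by simpa using hneg H)
      (fun {b _} H => by simpa using hleft b H) (fun {_ b} H => by simpa using hright b H)
    have h1 : 1 ∈ J := hA.one_mem J (x := a) ((TwoSidedIdeal.mem_mk' ..).2 ha) ha0
    have h1I := (TwoSidedIdeal.mem_mk' ..).1 h1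
    exact hI1 h1I
  obtain ⟨a, x, hax, hx0⟩ : ∃ a x, crossed h a x ∈ I ∧ x ≠ 0 := by
    by_contra! H
    refine hI (eq_bot_iff.2 fun m hm => ?_)
    obtain ⟨a, x, rfl⟩ := exists_eq_crossed h m
    obtain rfl := H a x hm
    rw [hdiag hm, crossed_zero]
    exact TwoSidedIdeal.zero_mem _
  -- The `u`-coefficients of elements of `I` form a nonzero ideal of `A`, so the coefficient 1
  -- occurs.
  let J : TwoSidedIdeal A := .mk' {x | ∃ a, crossed h a x ∈ I} ⟨0, hzero⟩
    (by rintro _ _ ⟨a, H⟩ ⟨b, H'⟩; exact ⟨a + b, hadd H H'⟩)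
    (by rintro _ ⟨a, H⟩; exact ⟨-a, hneg H⟩)
    (by rintro b _ ⟨a, H⟩; exact ⟨b * a, hleft b H⟩)
    (by
      rintro x b ⟨a, H⟩
      -- Multiplying `a + x u` on the right by `c` turns `x` into `x α(c)`; hence `c = α⁻¹(b)`.
      refine ⟨a * α.symm b, ?_⟩
      simpa using hright (α.symm b) H)
  have h1J : 1 ∈ J := hA.one_mem J (x := x) ((TwoSidedIdeal.mem_mk' ..).2 ⟨a, hax⟩) hx0
  obtain ⟨a, ha⟩ := (TwoSidedIdeal.mem_mk' ..).1 h1J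
  -- In `α(b)(a + u) - (a + u) b` the `u`-parts cancel, so the difference lies in `I ∩ A = 0`.
  have hint (b : A) : α b * a = a * b := by
    have := hadd (hleft (α b) ha) (hneg (hright b ha))
    rw [mul_one, one_mul, add_neg_cancel] at this
    rw [← sub_eq_zero, sub_eq_add_neg]
    exact hdiag this
  obtain rfl : a = 0 := by
    by_contra ha0
    exact not_isOuter_of_intertwiner hA ha0 hint hout
  -- Now `u ∈ I`, so `z = u²` lies in `I ∩ A = 0`, which no unitary can.
  have hz : crossed h z 0 ∈ I := by
    simpa [crossed_mul] using I.mul_mem_left (crossed h 0 1) _ ha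
  have hz0 := h.mem_unitary.1
  rw [hdiag hz, mul_zero] at hz0
  exact zero_ne_one hz0

/-- If `α = Ad w` then `w* u` is central in `B`. -/
lemma crossed_star_commutes (h : IsTwoZInner α z) {w : A} (hw : w ∈ unitary A)
    (hα : ∀ a, α a = w * a * star w) (m : indexTwoAlgebra (twistedInvolution h)) :
    m * crossed h 0 (star w) = crossed h 0 (star w) * m := by
  obtain ⟨a, x, rfl⟩ := exists_eq_crossed h m
  have hint (b : A) : star w * α b = b * star w := by
    rw [hα, ← mul_assoc, ← mul_assoc, hw.1, one_mul]
  -- Commuting `w* u` with `A` needs only `hint`; commuting it with `x u` compares `x α(w*) z` with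
  -- `w* α(x) z`, which also requires `α` to fix `w*`.
  have hfix : α (star w) = star w := by
    rw [hα, hw.2, one_mul]
  rw [crossed_mul, crossed_mul, hint, hint, hfix]
  simp

/-- Scalars have `u`-coefficient 0, whereas a unitary of a nonzero algebra is nonzero. -/
lemma crossed_star_ne_algebraMap (hA : IsSimpleCStarAlgebra A) (h : IsTwoZInner α z) {w : A}
    (hw : w ∈ unitary A) (c : ℂ) : crossed h 0 (star w) ≠ algebraMap ℂ _ c := by
  have := hA.1
  rw [← crossed_scalar, Ne, crossed_inj]
  rintro ⟨-, hw0⟩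
  have h1 := hw.1
  rw [hw0, zero_mul] at h1
  exact zero_ne_one h1

lemma not_isSimple_of_inner (hA : IsSimpleCStarAlgebra A) (h : IsTwoZInner α z) {w : A}
    (hw : w ∈ unitary A) (hα : ∀ a, α a = w * a * star w) :
    ¬ IsSimpleCStarAlgebra (indexTwoAlgebra (twistedInvolution h)) := by
  intro hB
  obtain ⟨c, hc⟩ := hB.exists_eq_algebraMap fun b => (crossed_star_commutes h hw hα b).symm
  exact crossed_star_ne_algebraMap hA h hw c hc

end Commutants

end BimoduleIndexTwo

theorem mainTheorem3 {A : Type*} [CStarAlgebra A] [PartialOrder A] [StarOrderedRing A]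
    (hA : BimoduleIndexTwo.IsSimpleCStarAlgebra A) (α : A ≃⋆ₐ[ℂ] A) (z : A)
    (h : BimoduleIndexTwo.IsTwoZInner α z) :
    let L := BimoduleIndexTwo.Linking A (BimoduleIndexTwo.TwistedBimodule α)
    let B : StarSubalgebra ℂ L :=
      BimoduleIndexTwo.indexTwoAlgebra (BimoduleIndexTwo.twistedInvolution h)
    let A' : Set L := Set.centralizer (BimoduleIndexTwo.Linking.diag A _)
    let B' : Set L := Set.centralizer (B : Set L)
    List.TFAE
      [BimoduleIndexTwo.IsSimpleCStarAlgebra B,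
       A' ∩ (B : Set L) = Set.range (algebraMap ℂ L),
       B' = Set.range (algebraMap ℂ L),
       BimoduleIndexTwo.IsOuter α] := by
  intro L B A' B'
  tfae_have 4 → 1 := BimoduleIndexTwo.isSimple_of_isOuter hA h
  tfae_have 4 → 2 := BimoduleIndexTwo.centralizer_inter_eq_of_isOuter hA h
  tfae_have 4 → 3 := BimoduleIndexTwo.centralizer_eq_of_isOuter hA h
  tfae_have 1 → 4 := fun hB => by
    rintro ⟨w, hw, hα⟩
    exact BimoduleIndexTwo.not_isSimple_of_inner hA h hw hα hB
  tfae_have 2 → 4 := fun h2 => by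
    rintro ⟨w, hw, hα⟩
    -- The element `w* u` is central in `B`, so in particular it commutes with `A`.
    have hv : (BimoduleIndexTwo.crossed h 0 (star w) : L) ∈ A' ∩ (B : Set L) :=
      ⟨fun m hm => congrArg Subtype.val (BimoduleIndexTwo.crossed_star_commutes h hw hα
        ⟨m, BimoduleIndexTwo.diag_subset h hm⟩), Subtype.property _⟩
    rw [h2] at hv
    obtain ⟨c, hc⟩ := hv
    exact BimoduleIndexTwo.crossed_star_ne_algebraMap hA h hw c (Subtype.ext hc.symm)
  tfae_have 3 → 4 := fun h3 => by
    rintro ⟨w, hw, hα⟩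
    have hv : (BimoduleIndexTwo.crossed h 0 (star w) : L) ∈ B' := fun m hm =>
      congrArg Subtype.val (BimoduleIndexTwo.crossed_star_commutes h hw hα ⟨m, hm⟩)
    rw [h3] at hv
    obtain ⟨c, hc⟩ := hv
    exact BimoduleIndexTwo.crossed_star_ne_algebraMap hA h hw c (Subtype.ext hc.symm)
  tfae_finish
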